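/- A simple polygon is a closed region of the plane bounded by a closed polygonal chain whose edges are pairwise disjoint, except that consecutive edges share their common endpoint; its vertices are the corners of the chain (consecutive edges are not collinear). For a finite point set $S\subset\mathbb{R}^2$ let $\mathcal{P}(S)$ be the set of all simple polygons whose vertex set is exactly $S$. A point $p\in P$ sees $q\in P$ with respect to a polygon $P$ if the segment $pq$ is contained in $P$. A set $G\subseteq S$ is a guard set for $P\in\mathcal{P}(S)$ if every point of $P$ is seen, with respect to $P$, by some $g\in G$, and a guard set for a set $A\subseteq\mathcal{P}(S)$ if it is a guard set for each $P\in A$. Let $\mathrm{ug}(A)$ be the minimum cardinality of a guard set $G \subseteq S$ for $A$. The $3$-universal guard number is $$\mathrm{UG}^3(n)=\max_{\substack{S\subset\mathbb{R}^2\\ |S|=n}}\ \max_{\substack{A\subseteq\mathcal{P}(S)\\ |A|=3}}\ \mathrm{ug}(A).$$ Theorem. For every integer $n\ge 4$, $$\mathrm{UG}^3(n)\ \ge\ \left\lfloor \frac{4n}{9}\right\rfloor .$$ -/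

import Mathlib

namespace UniversalGuards

/-- The Euclidean plane. -/
abbrev Plane : Type := EuclideanSpace ℝ (Fin 2)

/-- A closed polygonal chain with vertices `p 0, …, p (n - 1)` (in cyclic order) is *simple* if
no three cyclically consecutive vertices are collinear (every vertex is a genuine corner), and two
different edges have no point in common, except that cyclically adjacent edges share their common
endpoint. In particular the vertices are pairwise distinct and `3 ≤ n`. -/
def IsSimple {n : ℕ} [NeZero n] (p : Polygon Plane n) : Prop :=
  p.HasNondegenerateVertices ℝ ∧
    ∀ i j : Fin n, i ≠ j → ∀ x : Plane, x ∈ p.edgeSet ℝ i → x ∈ p.edgeSet ℝ j →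
      (j = i + 1 ∧ x = p j) ∨ (i = j + 1 ∧ x = p i)

/-- The closed region bounded by a closed polygonal chain: the chain itself, together with all
points whose connected component in the complement of the chain is bounded. -/
def region {n : ℕ} (p : Polygon Plane n) : Set Plane :=
  p.boundary ℝ ∪
    {x | x ∉ p.boundary ℝ ∧ Bornology.IsBounded (connectedComponentIn (p.boundary ℝ)ᶜ x)}

/-- The set of all simple polygons (as closed regions of the plane) whose vertex set is `S`. -/
def simplePolygons (S : Finset Plane) : Set (Set Plane) :=
  {P | ∃ (n : ℕ) (_ : NeZero n) (p : Polygon Plane n),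
    IsSimple p ∧ Set.range p.vertices = (S : Set Plane) ∧ P = region p}

/-- `p` sees `q` with respect to `P` if the segment `pq` is contained in `P`. -/
def Sees (P : Set Plane) (p q : Plane) : Prop := segment ℝ p q ⊆ P

/-- The visible region of `g` with respect to `P`. -/
def visibleRegion (P : Set Plane) (g : Plane) : Set Plane := {a | a ∈ P ∧ Sees P g a}

/-- `G` is a guard set for `P` if the visible regions of its points cover `P`. -/
def IsGuardSet (G : Finset Plane) (P : Set Plane) : Prop := ⋃ g ∈ G, visibleRegion P g = P

/-- The minimum cardinality of a set `G ⊆ S` that is a guard set for every polygon in `A`. -/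
noncomputable def guardNumber (S : Finset Plane) (A : Set (Set Plane)) : ℕ∞ :=
  ⨅ (G : Finset Plane) (_ : G ⊆ S ∧ ∀ P ∈ A, IsGuardSet G P), (G.card : ℕ∞)

/-- The `k`-universal guard number for simple polygons: the maximum of `guardNumber S A` over all
`n`-point sets `S` in the plane and all sets `A` of exactly `k` simple polygons with vertex set
`S`. -/
noncomputable def kUniversalGuardNumber (k n : ℕ) : ℕ∞ :=
  ⨆ (S : Finset Plane) (_ : S.card = n) (A : Set (Set Plane))
    (_ : A ⊆ simplePolygons S ∧ A.encard = k), guardNumber S A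

end UniversalGuards

namespace UniversalGuards

/-! The points come in blocks of nine, plus one block for the remainder. Each block fits in a box of
size 80 by 40, and consecutive blocks are 10000 apart horizontally. Polygon `k` visits all points in
increasing order of `x + slope k * y`, with slopes -1, 0, 1, and closes up along a bottom chord.
Monotonicity makes it simple (`IsMonotoneChain.isSimple`), and everything above the chain lies
outside it (`notMem_region_of_orient_pos`).

A tip is a chain vertex such that every vertex before its predecessor lies strictly left of its
incoming edge, and every vertex after its successor strictly left of its outgoing edge. Sight lines
from such vertices to the tip leave the polygon, so a guard must stand at the tip or at a chain
neighbour (`exists_mem_guardSet`). Over the three polygons the tips of a full block give ten triples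
of its points that no three points hit; a block of `N` points needs `4 * N / 9` guards
(`le_sum_of_hits`). Tips remain tips when the blocks are joined (`vertex_tip_left`,
`vertex_tip_right`), so the block bounds add up (`le_sum_of_le_sum_blocks`). For `n = 4` the blocks
do not give three different polygons, and a triangle with an interior point is used instead. -/

/-- Twice the signed area of the triangle `a b c`. -/
noncomputable def orient (a b c : Plane) : ℝ :=
  (b 0 - a 0) * (c 1 - a 1) - (b 1 - a 1) * (c 0 - a 0)

/-- The linear functional with coefficients `α` and `β`. -/
noncomputable def level (α β : ℝ) (z : Plane) : ℝ := α * z 0 + β * z 1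

theorem affineIndependent_of_orient_ne_zero {a b c : Plane} (h : orient a b c ≠ 0) :
    AffineIndependent ℝ ![a, b, c] := by
  rw [affineIndependent_iff_not_collinear_set]
  intro hc
  obtain ⟨v, hv⟩ := (collinear_iff_of_mem (p₀ := a) (by simp)).1 hc
  obtain ⟨r, hr⟩ := hv b (by simp)
  obtain ⟨s, hs⟩ := hv c (by simp)
  apply h
  subst hr hs
  simp [orient]
  ring

/-! ### Monotone chains and their simplicity -/

/-- The chain `p 0, …, p (n - 1)` is strictly monotone in a direction, no three consecutive
vertices are collinear, and it lies to the left of the chord that closes it. -/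
structure IsMonotoneChain (α β : ℝ) (n : ℕ) (p : ℕ → Plane) : Prop where
  three_le : 3 ≤ n
  level_lt : ∀ i, i + 1 < n → level α β (p i) < level α β (p (i + 1))
  above : ∀ i, 0 < i → i + 1 < n → 0 < orient (p 0) (p (n - 1)) (p i)
  turn : ∀ i, i + 2 < n → orient (p i) (p (i + 1)) (p (i + 2)) ≠ 0

/-- The closed polygonal chain with vertices `p 0, …, p (n - 1)`. -/
def chainPolygon (n : ℕ) (p : ℕ → Plane) : Polygon Plane n := ⟨fun i => p i⟩

variable {α β : ℝ} {n : ℕ} {p : ℕ → Plane}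

theorem finRotate_val_of_lt {i : Fin n} (h : (i : ℕ) + 1 < n) :
    ((finRotate n i : Fin n) : ℕ) = i + 1 := by
  obtain ⟨m, rfl⟩ : ∃ m, n = m + 1 := ⟨n - 1, by omega⟩
  exact coe_finRotate_of_ne_last (fun h' => by subst h'; simp at h)

theorem finRotate_val_of_eq {i : Fin n} (h : (i : ℕ) + 1 = n) :
    ((finRotate n i : Fin n) : ℕ) = 0 := by
  obtain ⟨m, rfl⟩ : ∃ m, n = m + 1 := ⟨n - 1, by omega⟩
  have : i = Fin.last m := by ext; simp; omega
  subst this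
  simp

theorem mem_edgeSet_of_lt {i : Fin n} (h : (i : ℕ) + 1 < n) {z : Plane} :
    z ∈ (chainPolygon n p).edgeSet ℝ i ↔
      ∃ t : ℝ, 0 ≤ t ∧ t ≤ 1 ∧ z = AffineMap.lineMap (p i) (p (i + 1)) t := by
  simp only [Polygon.edgeSet, affineSegment, chainPolygon, finRotate_val_of_lt h, Set.mem_image,
    Set.mem_Icc, and_assoc, eq_comm]

theorem mem_edgeSet_of_eq {i : Fin n} (h : (i : ℕ) + 1 = n) {z : Plane} :
    z ∈ (chainPolygon n p).edgeSet ℝ i ↔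
      ∃ t : ℝ, 0 ≤ t ∧ t ≤ 1 ∧ z = AffineMap.lineMap (p (n - 1)) (p 0) t := by
  have h' : (i : ℕ) = n - 1 := by omega
  simp only [Polygon.edgeSet, affineSegment, chainPolygon, finRotate_val_of_eq h, Set.mem_image,
    Set.mem_Icc, and_assoc, eq_comm, h']

theorem lineMap_apply_coord (a b : Plane) (t : ℝ) (k : Fin 2) :
    (AffineMap.lineMap a b t : Plane) k = a k + t * (b k - a k) := by
  simp [AffineMap.lineMap_apply]
  ring

theorem level_lineMap (a b : Plane) (t : ℝ) :
    level α β (AffineMap.lineMap a b t) = level α β a + t * (level α β b - level α β a) := by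
  simp only [level, lineMap_apply_coord]
  ring

theorem orient_lineMap (u v a b : Plane) (t : ℝ) :
    orient u v (AffineMap.lineMap a b t) = (1 - t) * orient u v a + t * orient u v b := by
  simp only [orient, lineMap_apply_coord]
  ring

@[simp] theorem orient_left (a b : Plane) : orient a b a = 0 := by simp [orient]

@[simp] theorem orient_right (a b : Plane) : orient a b b = 0 := by
  simp only [orient]; ring

theorem lt_of_forall_lt_succ {γ : Type*} [Preorder γ] {f : ℕ → γ}
    (h : ∀ i, i + 1 < n → f i < f (i + 1)) {i j : ℕ} (hij : i < j) (hj : j < n) : f i < f j := by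
  induction j, hij using Nat.le_induction with
  | base => exact h i hj
  | succ k hk ih => exact (ih (by omega)).trans (h k hj)

namespace IsMonotoneChain

theorem level_lt_of_lt (hp : IsMonotoneChain α β n p) {i j : ℕ} (hij : i < j) (hj : j < n) :
    level α β (p i) < level α β (p j) :=
  lt_of_forall_lt_succ hp.level_lt hij hj

theorem level_le_of_le (hp : IsMonotoneChain α β n p) {i j : ℕ} (hij : i ≤ j) (hj : j < n) :
    level α β (p i) ≤ level α β (p j) := by
  rcases hij.eq_or_lt with rfl | h
  · exact le_rfl
  · exact (hp.level_lt_of_lt h hj).le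

theorem orient_chord_nonneg (hp : IsMonotoneChain α β n p) {i : ℕ} (hi : i < n) :
    0 ≤ orient (p 0) (p (n - 1)) (p i) := by
  rcases Nat.eq_zero_or_pos i with rfl | h0
  · simp
  · rcases (show i + 1 = n ∨ i + 1 < n by omega) with h | h
    · have : i = n - 1 := by omega
      simp [this]
    · exact (hp.above i h0 h).le

theorem level_lineMap_mem (hp : IsMonotoneChain α β n p) {i : ℕ} (hi : i + 1 < n) {t : ℝ}
    (h0 : 0 ≤ t) (h1 : t ≤ 1) :
    level α β (p i) ≤ level α β (AffineMap.lineMap (p i) (p (i + 1)) t) ∧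
      level α β (AffineMap.lineMap (p i) (p (i + 1)) t) ≤ level α β (p (i + 1)) := by
  have := hp.level_lt i hi
  rw [level_lineMap]
  constructor <;> nlinarith

/-- The edges occupy consecutive level intervals, which overlap at most in an endpoint; a level is
attained only once on an edge. -/
theorem eq_vertex_of_mem_edges (hp : IsMonotoneChain α β n p) {i j : ℕ} (hij : i < j)
    (hj : j + 1 < n) {s t : ℝ} (hs0 : 0 ≤ s) (hs1 : s ≤ 1) (ht0 : 0 ≤ t) (ht1 : t ≤ 1)
    (h : (AffineMap.lineMap (p i) (p (i + 1)) s : Plane) =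
      AffineMap.lineMap (p j) (p (j + 1)) t) :
    j = i + 1 ∧ (AffineMap.lineMap (p i) (p (i + 1)) s : Plane) = p j := by
  have h1 := (hp.level_lineMap_mem (i := i) (by omega) hs0 hs1).2
  have h2 := (hp.level_lineMap_mem hj ht0 ht1).1
  rw [← h] at h2
  have h3 := hp.level_le_of_le (show i + 1 ≤ j from hij) (by omega)
  have hji : j = i + 1 := by
    by_contra hne
    have := hp.level_lt_of_lt (show i + 1 < j by omega) (by omega)
    linarith
  refine ⟨hji, ?_⟩
  have h4 : level α β (AffineMap.lineMap (p j) (p (j + 1)) t) = level α β (p j) := by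
    rw [← h]; linarith
  rw [level_lineMap] at h4
  have h5 := hp.level_lt j hj
  have ht : t = 0 := by
    by_contra hne
    have : 0 < t := lt_of_le_of_ne ht0 (Ne.symm hne)
    nlinarith
  rw [h, ht, AffineMap.lineMap_apply_zero]

/-- Inner vertices are strictly left of the chord, so an edge can reach the line of the chord only
at an end of the chain. -/
theorem eq_end_of_mem_chord (hp : IsMonotoneChain α β n p) {i : ℕ} (hi : i + 1 < n) {s t : ℝ}
    (hs0 : 0 ≤ s) (hs1 : s ≤ 1)
    (h : (AffineMap.lineMap (p i) (p (i + 1)) s : Plane) =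
      AffineMap.lineMap (p (n - 1)) (p 0) t) :
    (i = 0 ∧ (AffineMap.lineMap (p i) (p (i + 1)) s : Plane) = p 0) ∨
      (i + 2 = n ∧ (AffineMap.lineMap (p i) (p (i + 1)) s : Plane) = p (n - 1)) := by
  have h3 := hp.three_le
  have hz : orient (p 0) (p (n - 1)) (AffineMap.lineMap (p i) (p (i + 1)) s) = 0 := by
    rw [h, orient_lineMap]; simp
  rw [orient_lineMap] at hz
  rcases Nat.eq_zero_or_pos i with rfl | h0
  · left
    have h1 := hp.above 1 one_pos (by omega)
    simp only [orient_left, mul_zero, zero_add] at hz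
    have : s = 0 := by
      rcases mul_eq_zero.1 hz with h | h
      · exact h
      · linarith
    simp [this]
  · have ha := hp.above i h0 hi
    rcases (show i + 2 = n ∨ i + 2 < n by omega) with h2 | h2
    · right
      have hn : n - 1 = i + 1 := by omega
      rw [hn] at hz ha
      simp only [orient_right, mul_zero, add_zero] at hz
      have : 1 - s = 0 := by
        rcases mul_eq_zero.1 hz with h | h
        · exact h
        · linarith
      have hs : s = 1 := by linarith
      exact ⟨h2, by simp [hs, hn]⟩
    · have hb := hp.above (i + 1) (by omega) (by omega)
      exfalso
      rcases hs1.eq_or_lt with rfl | hlt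
      · linarith
      · have := mul_pos (sub_pos.2 hlt) ha
        have := mul_nonneg hs0 hb.le
        linarith

theorem isSimple [NeZero n] (hp : IsMonotoneChain α β n p) : IsSimple (chainPolygon n p) := by
  have h3 := hp.three_le
  have hv : ∀ i : Fin n, ((i + 1 : Fin n) : ℕ) = if (i : ℕ) + 1 < n then (i : ℕ) + 1 else 0 := by
    intro i
    rw [Fin.val_add, Fin.val_one', Nat.mod_eq_of_lt (show 1 < n by omega)]
    split_ifs with h
    · exact Nat.mod_eq_of_lt h
    · rw [show (i : ℕ) + 1 = n by omega, Nat.mod_self]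
  have hv2 : ∀ i : Fin n, ((i + 2 : Fin n) : ℕ) =
      if (i : ℕ) + 2 < n then (i : ℕ) + 2 else (i : ℕ) + 2 - n := by
    intro i
    have h2 : ((2 : Fin n) : ℕ) = 2 := Nat.mod_eq_of_lt (show 2 < n by omega)
    rw [Fin.val_add, h2]
    split_ifs with h
    · exact Nat.mod_eq_of_lt h
    · rw [Nat.mod_eq_sub_mod (by omega), Nat.mod_eq_of_lt (by omega)]
  constructor
  · intro i
    apply affineIndependent_of_orient_ne_zero
    simp only [chainPolygon, hv, hv2]
    rcases (show (i : ℕ) + 2 < n ∨ (i : ℕ) + 2 = n ∨ (i : ℕ) + 1 = n by omega) with h | h | h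
    · rw [if_pos (by omega), if_pos h]
      exact hp.turn i h
    · rw [if_pos (by omega), if_neg (by omega), show (i : ℕ) + 2 - n = 0 by omega,
        show (i : ℕ) + 1 = n - 1 by omega]
      have := hp.above i (by omega) (by omega)
      have h2 : orient (p i) (p (n - 1)) (p 0) = - orient (p 0) (p (n - 1)) (p i) := by
        simp only [orient]; ring
      rw [h2]
      exact neg_ne_zero.2 this.ne'
    · rw [if_neg (by omega), if_neg (by omega), show (i : ℕ) + 2 - n = 1 by omega,
        show (i : ℕ) = n - 1 by omega]
      have := hp.above 1 (by omega) (by omega)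
      have h2 : orient (p (n - 1)) (p 0) (p 1) = - orient (p 0) (p (n - 1)) (p 1) := by
        simp only [orient]; ring
      rw [h2]
      exact neg_ne_zero.2 this.ne'
  · have key : ∀ i j : Fin n, (i : ℕ) < j → ∀ x : Plane, x ∈ (chainPolygon n p).edgeSet ℝ i →
        x ∈ (chainPolygon n p).edgeSet ℝ j →
        (j = i + 1 ∧ x = (chainPolygon n p) j) ∨ (i = j + 1 ∧ x = (chainPolygon n p) i) := by
      intro i j hij x hxi hxj
      have hi : (i : ℕ) + 1 < n := by omega
      obtain ⟨s, hs0, hs1, rfl⟩ := (mem_edgeSet_of_lt hi).1 hxi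
      rcases (show (j : ℕ) + 1 < n ∨ (j : ℕ) + 1 = n by omega) with hj | hj
      · obtain ⟨t, ht0, ht1, h⟩ := (mem_edgeSet_of_lt hj).1 hxj
        obtain ⟨h1, h2⟩ := hp.eq_vertex_of_mem_edges hij hj hs0 hs1 ht0 ht1 h
        exact Or.inl ⟨by ext; rw [hv, if_pos hi, h1], h2⟩
      · obtain ⟨t, ht0, ht1, h⟩ := (mem_edgeSet_of_eq hj).1 hxj
        rcases hp.eq_end_of_mem_chord hi hs0 hs1 h with ⟨h1, h2⟩ | ⟨h1, h2⟩
        · refine Or.inr ⟨by ext; rw [hv, if_neg (by omega), h1], ?_⟩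
          simpa only [chainPolygon, h1] using h2
        · refine Or.inl ⟨by ext; rw [hv, if_pos hi]; omega, ?_⟩
          have : (j : ℕ) = n - 1 := by omega
          simpa only [chainPolygon, this] using h2
    intro i j hij x hxi hxj
    rcases lt_or_gt_of_ne (fun h => hij (Fin.ext h) : (i : ℕ) ≠ j) with h | h
    · exact key i j h x hxi hxj
    · exact (key j i h x hxj hxi).symm

/-! ### The exterior above the chain -/

/-- A point strictly to the left of an edge is not on the chain. -/
theorem notMem_boundary_of_orient_pos (hp : IsMonotoneChain α β n p) {i : ℕ} (hi : i + 1 < n)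
    {z : Plane} (hl : level α β (p i) < level α β z) (hr : level α β z < level α β (p (i + 1)))
    (ho : 0 < orient (p i) (p (i + 1)) z) : z ∉ (chainPolygon n p).boundary ℝ := by
  intro hz
  have h3 := hp.three_le
  obtain ⟨j, hj⟩ := Set.mem_iUnion.1 hz
  rcases (show (j : ℕ) + 1 < n ∨ (j : ℕ) + 1 = n by omega) with h | h
  · obtain ⟨t, ht0, ht1, rfl⟩ := (mem_edgeSet_of_lt h).1 hj
    obtain ⟨h1, h2⟩ := hp.level_lineMap_mem h ht0 ht1
    rcases lt_trichotomy (j : ℕ) i with hji | hji | hji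
    · have := hp.level_le_of_le (show (j : ℕ) + 1 ≤ i from hji) (by omega)
      linarith
    · rw [hji, orient_lineMap] at ho
      simp at ho
    · have := hp.level_le_of_le (show i + 1 ≤ (j : ℕ) from hji) (by omega)
      linarith
  · obtain ⟨t, ht0, ht1, rfl⟩ := (mem_edgeSet_of_eq h).1 hj
    set z : Plane := AffineMap.lineMap (p (n - 1)) (p 0) t with hzdef
    have hz0 : orient (p 0) (p (n - 1)) z = 0 := by
      rw [hzdef, orient_lineMap]; simp
    -- The edge point at the level of `z` is weakly left of the chord, and `z` is strictly beyond
    -- it; the identity adds these two displacements without dividing.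
    have hid : (level α β (p (i + 1)) - level α β (p i)) * orient (p 0) (p (n - 1)) z =
        (level α β (p (i + 1)) - level α β z) * orient (p 0) (p (n - 1)) (p i) +
        (level α β z - level α β (p i)) * orient (p 0) (p (n - 1)) (p (i + 1)) +
        (level α β (p (n - 1)) - level α β (p 0)) * orient (p i) (p (i + 1)) z := by
      simp only [level, orient]
      ring
    have ha := hp.orient_chord_nonneg (i := i) (by omega)
    have hb := hp.orient_chord_nonneg hi
    have hc := hp.level_lt_of_lt (show 0 < n - 1 by omega) (by omega)
    rw [hz0, mul_zero] at hid
    have := mul_nonneg (sub_pos.2 hr).le ha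
    have := mul_nonneg (sub_pos.2 hl).le hb
    have := mul_pos (sub_pos.2 hc) ho
    linarith

/-- A point strictly to the left of an edge is outside the polygon. -/
theorem notMem_region_of_orient_pos (hp : IsMonotoneChain α β n p) {i : ℕ} (hi : i + 1 < n)
    {z : Plane} (hl : level α β (p i) < level α β z) (hr : level α β z < level α β (p (i + 1)))
    (ho : 0 < orient (p i) (p (i + 1)) z) : z ∉ region (chainPolygon n p) := by
  rintro (hz | ⟨-, hb⟩)
  · exact hp.notMem_boundary_of_orient_pos hi hl hr ho hz
  -- This direction keeps the level fixed and moves left of the edge, so the ray from `z` avoids the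
  -- boundary and makes its component unbounded.
  let w : Plane := !₂[-β, α]
  have hw0 : w 0 = -β := by simp [w]
  have hw1 : w 1 = α := by simp [w]
  have hlt := hp.level_lt i hi
  have hsub : (fun s : ℝ => z + s • w) '' Set.Ici 0 ⊆
      connectedComponentIn ((chainPolygon n p).boundary ℝ)ᶜ z := by
    apply IsPreconnected.subset_connectedComponentIn
    · exact isPreconnected_Ici.image _ (by fun_prop)
    · exact ⟨0, by simp, by simp⟩
    · rintro _ ⟨s, hs, rfl⟩
      have hlev : level α β (z + s • w) = level α β z := by
        simp [level, hw0, hw1]; ring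
      refine hp.notMem_boundary_of_orient_pos hi (by rwa [hlev]) (by rwa [hlev]) ?_
      have : orient (p i) (p (i + 1)) (z + s • w) = orient (p i) (p (i + 1)) z +
          s * (level α β (p (i + 1)) - level α β (p i)) := by
        simp [orient, level, hw0, hw1]; ring
      rw [this]
      have := mul_nonneg hs (sub_pos.2 hlt).le
      linarith
  have hw : w ≠ 0 := by
    intro h
    have hβ : β = 0 := by simpa [h] using hw0.symm
    have hα : α = 0 := by simpa [h] using hw1.symm
    simp [level, hα, hβ] at hlt
  obtain ⟨C, hC⟩ := (hb.subset hsub).exists_norm_le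
  have hwpos : 0 < ‖w‖ := norm_pos_iff.2 hw
  have hCz : 0 ≤ (|C| + ‖z‖ + 1) / ‖w‖ := by positivity
  have h1 := hC _ ⟨(|C| + ‖z‖ + 1) / ‖w‖, hCz, rfl⟩
  have h2 : ‖((|C| + ‖z‖ + 1) / ‖w‖) • w‖ = |C| + ‖z‖ + 1 := by
    rw [norm_smul, Real.norm_of_nonneg hCz, div_mul_cancel₀ _ hwpos.ne']
  have h3 := norm_sub_le (z + ((|C| + ‖z‖ + 1) / ‖w‖) • w) z
  rw [add_sub_cancel_left, h2] at h3
  have := le_abs_self C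
  simp only at h1
  linarith

theorem vertex_mem_region (i : ℕ) (hi : i < n) : p i ∈ region (chainPolygon n p) := by
  refine Or.inl (Set.mem_iUnion.2 ⟨⟨i, hi⟩, ?_⟩)
  exact ⟨0, by simp, by simp [chainPolygon]⟩

theorem midpoint_mem_region {i : ℕ} (hi : i + 1 < n) :
    AffineMap.lineMap (p i) (p (i + 1)) (1 / 2 : ℝ) ∈ region (chainPolygon n p) :=
  Or.inl (Set.mem_iUnion.2 ⟨⟨i, by omega⟩,
    (mem_edgeSet_of_lt hi).2 ⟨1 / 2, by norm_num, by norm_num, rfl⟩⟩)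

theorem chord_midpoint_mem_region (hn : 0 < n) :
    AffineMap.lineMap (p (n - 1)) (p 0) (1 / 2 : ℝ) ∈ region (chainPolygon n p) :=
  Or.inl (Set.mem_iUnion.2 ⟨⟨n - 1, by omega⟩,
    (mem_edgeSet_of_eq (Nat.sub_add_cancel hn)).2 ⟨1 / 2, by norm_num, by norm_num, rfl⟩⟩)

/-! ### Visibility of tips -/

/-- If the cone at the vertex `p i` contains no other vertex, then only `p i` and its two
neighbours see it. -/
theorem not_sees (hp : IsMonotoneChain α β n p) {i j : ℕ} (h0 : 0 < i) (hi : i + 1 < n)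
    (hj : j < n) (hij : j + 1 < i ∨ i + 1 < j)
    (hl : j + 1 < i → 0 < orient (p (i - 1)) (p i) (p j))
    (hr : i + 1 < j → 0 < orient (p i) (p (i + 1)) (p j)) :
    ¬ Sees (region (chainPolygon n p)) (p j) (p i) := by
  obtain ⟨i, rfl⟩ : ∃ k, i = k + 1 := ⟨i - 1, by omega⟩
  intro hs
  have hmem : ∀ t : ℝ, 0 ≤ t → t ≤ 1 →
      AffineMap.lineMap (p (i + 1)) (p j) t ∈ region (chainPolygon n p) := by
    intro t ht0 ht1
    apply hs
    rw [segment_symm, segment_eq_image_lineMap]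
    exact ⟨t, ⟨ht0, ht1⟩, rfl⟩
  rcases hij with h | h
  · have ho := hl h
    rw [Nat.add_sub_cancel] at ho
    have h1 := hp.level_lt i (by omega)
    have h2 := hp.level_lt_of_lt (show j < i by omega) (by omega)
    set d := level α β (p (i + 1)) - level α β (p i) with hd
    set e := level α β (p (i + 1)) - level α β (p j) with he
    -- The parameter `d / (2 * e)` selects the point of the sight line at the middle level of the
    -- adjacent edge, where it is strictly outside.
    have hde : d / (2 * e) * e = d / 2 := by
      have : e ≠ 0 := by linarith
      field_simp
    have ht0 : 0 < d / (2 * e) := div_pos (by linarith) (by linarith)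
    have ht1 : d / (2 * e) ≤ 1 := (div_le_one (by linarith)).2 (by linarith)
    refine hp.notMem_region_of_orient_pos (i := i) (by omega) ?_ ?_ ?_ (hmem _ ht0.le ht1)
    · rw [level_lineMap]; linarith
    · rw [level_lineMap]; linarith
    · rw [orient_lineMap, orient_right, mul_zero, zero_add]
      exact mul_pos ht0 ho
  · have ho := hr h
    have h1 := hp.level_lt (i + 1) (by omega)
    have h2 := hp.level_lt_of_lt h (by omega)
    set d := level α β (p (i + 1 + 1)) - level α β (p (i + 1)) with hd
    set e := level α β (p j) - level α β (p (i + 1)) with he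
    have hde : d / (2 * e) * e = d / 2 := by
      have : e ≠ 0 := by linarith
      field_simp
    have ht0 : 0 < d / (2 * e) := div_pos (by linarith) (by linarith)
    have ht1 : d / (2 * e) ≤ 1 := (div_le_one (by linarith)).2 (by linarith)
    refine hp.notMem_region_of_orient_pos (i := i + 1) (by omega) ?_ ?_ ?_ (hmem _ ht0.le ht1)
    · rw [level_lineMap]; linarith
    · rw [level_lineMap]; linarith
    · rw [orient_lineMap, orient_left, mul_zero, zero_add]
      exact mul_pos ht0 ho

/-- A vertex whose cone contains no other vertex forces a guard at it or at a neighbour. -/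
theorem exists_mem_guardSet (hp : IsMonotoneChain α β n p) {G : Finset Plane}
    (hG : ∀ g ∈ G, ∃ j < n, g = p j) (hguard : IsGuardSet G (region (chainPolygon n p)))
    {i : ℕ} (h0 : 0 < i) (hi : i + 1 < n)
    (hl : ∀ j, j + 1 < i → 0 < orient (p (i - 1)) (p i) (p j))
    (hr : ∀ j, i + 1 < j → j < n → 0 < orient (p i) (p (i + 1)) (p j)) :
    p (i - 1) ∈ G ∨ p i ∈ G ∨ p (i + 1) ∈ G := by
  have hmem : p i ∈ region (chainPolygon n p) := vertex_mem_region i (by omega)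
  rw [← hguard] at hmem
  obtain ⟨g, hg, -, hsee⟩ := Set.mem_iUnion₂.1 hmem
  obtain ⟨j, hj, rfl⟩ := hG g hg
  by_contra! hne
  obtain ⟨hne1, hne2, hne3⟩ := hne
  have : j + 1 < i ∨ i + 1 < j := by
    by_contra! h
    rcases (show j = i - 1 ∨ j = i ∨ j = i + 1 by omega) with rfl | rfl | rfl
    exacts [hne1 hg, hne2 hg, hne3 hg]
  exact hp.not_sees h0 hi hj this (hl j) (fun h => hr j h hj) hsee

theorem region_mem_simplePolygons (hp : IsMonotoneChain α β n p) {S : Finset Plane}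
    (hS : ∀ z, z ∈ S ↔ ∃ i < n, p i = z) : region (chainPolygon n p) ∈ simplePolygons S := by
  have h3 := hp.three_le
  have hn : NeZero n := ⟨by omega⟩
  refine ⟨n, hn, chainPolygon n p, hp.isSimple, ?_, rfl⟩
  ext z
  simp only [Set.mem_range, chainPolygon, Finset.mem_coe, hS]
  exact ⟨fun ⟨i, h⟩ => ⟨i, i.2, h⟩, fun ⟨i, hi, h⟩ => ⟨⟨i, hi⟩, h⟩⟩

theorem injOn (hp : IsMonotoneChain α β n p) : Set.InjOn p (Set.Iio n) := by
  intro i hi j hj h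
  rcases lt_trichotomy i j with h1 | h1 | h1
  · have := hp.level_lt_of_lt h1 hj
    rw [h] at this
    exact absurd this (lt_irrefl _)
  · exact h1
  · have := hp.level_lt_of_lt h1 hi
    rw [h] at this
    exact absurd this (lt_irrefl _)

end IsMonotoneChain

/-- Injectivity matters because the family must consist of exactly three polygons. -/
theorem le_kUniversalGuardNumber {n c : ℕ} {S : Finset Plane} (hS : S.card = n)
    {P : Fin 3 → Set Plane} (hP : ∀ k, P k ∈ simplePolygons S) (hinj : Function.Injective P)
    (h : ∀ G ⊆ S, (∀ k, IsGuardSet G (P k)) → c ≤ G.card) :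
    (c : ℕ∞) ≤ kUniversalGuardNumber 3 n := by
  have hcard : (Set.range P).encard = (3 : ℕ) := by
    rw [← Set.image_univ, hinj.encard_image, Set.encard_univ]
    simp
  refine le_trans ?_ (le_iSup₂_of_le S hS (le_iSup₂_of_le (Set.range P)
    ⟨Set.range_subset_iff.2 hP, hcard⟩ le_rfl))
  refine le_iInf₂ fun G hG => ?_
  exact_mod_cast h G hG.1 fun k => hG.2 _ ⟨k, rfl⟩

/-! ### The blocks and their finite verification -/

/-- The points of the blocks with up to nine points. -/
def blockPoints : ℕ → List (ℤ × ℤ)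
  | 1 => [(0, 1)]
  | 2 => [(0, 3), (10, 1)]
  | 3 => [(0, 1), (10, 5), (20, 1)]
  | 4 => [(0, 1), (10, 5), (15, 2), (20, 1)]
  | 5 => [(0, 1), (23, 15), (18, 6), (32, 2), (40, 1)]
  | 6 => [(0, 1), (28, 2), (18, 17), (24, 2), (15, 9), (40, 1)]
  | 7 => [(0, 1), (17, 3), (14, 7), (31, 5), (20, 19), (23, 2), (40, 1)]
  | 8 => [(0, 1), (10, 8), (16, 13), (24, 3), (20, 19), (18, 4), (27, 9), (40, 1)]
  | 9 => [(0, 1), (32, 5), (38, 9), (41, 37), (29, 17), (43, 9), (48, 29), (36, 3), (80, 1)]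
  | _ => []

/-- The order in which each of the three polygons visits the points of a block. -/
def blockOrder : ℕ → Fin 3 → List ℕ
  | 2 => fun _ => [0, 1]
  | 3 => fun _ => [0, 1, 2]
  | 4 => fun _ => [0, 1, 2, 3]
  | 5 => ![[0, 1, 2, 3, 4], [0, 2, 1, 3, 4], [0, 2, 3, 1, 4]]
  | 6 => ![[0, 2, 4, 3, 1, 5], [0, 4, 2, 3, 1, 5], [0, 4, 3, 1, 2, 5]]
  | 7 => ![[0, 4, 2, 1, 5, 3, 6], [0, 2, 1, 4, 5, 3, 6], [0, 1, 2, 5, 3, 4, 6]]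
  | 8 => ![[0, 4, 1, 2, 5, 6, 3, 7], [0, 1, 2, 5, 4, 3, 6, 7], [0, 1, 5, 3, 2, 6, 4, 7]]
  | 9 => ![[0, 3, 4, 6, 1, 2, 7, 5, 8], [0, 4, 1, 7, 2, 3, 5, 6, 8], [0, 1, 7, 4, 2, 5, 6, 3, 8]]
  | _ => fun _ => [0]

/-- The positions of the vertices of a block whose cones contain no other vertex. -/
def blockTips : ℕ → List (Fin 3 × ℕ)
  | 3 | 4 => [(0, 1)]
  | 5 => [(0, 1), (1, 2), (2, 1), (2, 3)]
  | 6 => [(0, 1), (1, 2), (2, 1), (2, 4)]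
  | 7 => [(0, 1), (0, 5), (1, 1), (1, 3), (1, 5), (2, 2), (2, 5)]
  | 8 => [(0, 1), (0, 3), (0, 5), (1, 2), (1, 4), (1, 6), (2, 1), (2, 6)]
  | 9 => [(0, 1), (0, 3), (0, 5), (0, 7), (1, 1), (1, 5), (1, 7), (2, 1), (2, 3), (2, 7)]
  | _ => []

/-- The label of the point of a block that polygon `k` visits at time `t`. -/
def blockLabel (N : ℕ) (k : Fin 3) (t : ℕ) : ℕ := (blockOrder N k).getD t 0

/-- The points of a block, the first or the last of them being lowered on demand. -/
def blockPoint (N : ℕ) (first last : Bool) (s : ℕ) : ℤ × ℤ :=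
  (((blockPoints N).getD s 0).1, ((blockPoints N).getD s 0).2 -
    if (first ∧ s = 0) ∨ (last ∧ s + 1 = N) then 1 else 0)

/-- The vertex of a block that polygon `k` visits at time `t`. -/
def blockVertex (N : ℕ) (first last : Bool) (k : Fin 3) (t : ℕ) : ℤ × ℤ :=
  blockPoint N first last (blockLabel N k t)

/-- Twice the signed area of an integral triangle. -/
def intOrient (a b c : ℤ × ℤ) : ℤ := (b.1 - a.1) * (c.2 - a.2) - (b.2 - a.2) * (c.1 - a.1)

/-- The coefficient of the second coordinate in the functional that orders polygon `k`. -/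
def slope (k : Fin 3) : ℤ := (k : ℕ) - 1

theorem blockVertex_level_lt : ∀ N < 10, ∀ (u v : Bool) (k : Fin 3), ∀ t < N, t + 1 < N →
    (blockVertex N u v k t).1 + slope k * (blockVertex N u v k t).2 <
      (blockVertex N u v k (t + 1)).1 + slope k * (blockVertex N u v k (t + 1)).2 := by
  decide +kernel

theorem blockVertex_mem_box : ∀ N < 10, ∀ (u v : Bool) (k : Fin 3), ∀ t < N,
    0 ≤ (blockVertex N u v k t).1 ∧ (blockVertex N u v k t).1 ≤ 80 ∧
      0 ≤ (blockVertex N u v k t).2 ∧ (blockVertex N u v k t).2 ≤ 40 := by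
  decide +kernel

-- Every order starts at label 0 and ends at label `N - 1`, so lowering by label is the same as
-- lowering by time.
set_option synthInstance.maxHeartbeats 400000 in
set_option synthInstance.maxSize 2000 in
theorem blockVertex_snd_pos : ∀ N < 10, ∀ (u v : Bool) (k : Fin 3), ∀ t < N,
    ¬(u = true ∧ t = 0) → ¬(v = true ∧ t + 1 = N) → 0 < (blockVertex N u v k t).2 := by
  decide +kernel

theorem blockVertex_snd_first : ∀ N < 10, 5 ≤ N → ∀ (v : Bool) (k : Fin 3),
    (blockVertex N true v k 0).2 = 0 := by
  decide +kernel

theorem blockVertex_snd_last : ∀ N < 10, 1 ≤ N → ∀ (u : Bool) (k : Fin 3),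
    (5 ≤ N ∨ u = false) → (blockVertex N u true k (N - 1)).2 = 0 := by
  decide +kernel

theorem blockVertex_turn : ∀ N < 10, ∀ (u v : Bool) (k : Fin 3), ∀ t < N, t + 2 < N →
    intOrient (blockVertex N u v k t) (blockVertex N u v k (t + 1))
      (blockVertex N u v k (t + 2)) ≠ 0 := by
  decide +kernel

/-- Together with `blockVertex_snd_last_ne`, this rules out collinear triples across the seam of two
blocks: a non-horizontal edge cannot continue straight into a block so far away. -/
theorem blockVertex_snd_zero_ne : ∀ N < 10, 2 ≤ N → ∀ (v : Bool) (k : Fin 3),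
    (blockVertex N false v k 0).2 ≠ (blockVertex N false v k 1).2 := by
  decide +kernel

theorem blockVertex_snd_last_ne : ∀ (u v : Bool) (k : Fin 3),
    (blockVertex 9 u v k 7).2 ≠ (blockVertex 9 u v k 8).2 := by
  decide +kernel

theorem blockTips_bounds : ∀ N < 10, ∀ q ∈ blockTips N, 0 < q.2 ∧ q.2 + 1 < N := by
  decide +kernel

/-- A tip above both neighbours has edges whose lines drop far below all other blocks. -/
theorem blockTips_snd_lt : ∀ N < 10, ∀ (u v : Bool), ∀ q ∈ blockTips N,
    (blockVertex N u v q.1 (q.2 - 1)).2 < (blockVertex N u v q.1 q.2).2 ∧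
      (blockVertex N u v q.1 (q.2 + 1)).2 < (blockVertex N u v q.1 q.2).2 := by
  decide +kernel

theorem blockTips_orient_left : ∀ N < 10, ∀ (u v : Bool), ∀ q ∈ blockTips N, ∀ j < N,
    j + 1 < q.2 → 0 < intOrient (blockVertex N u v q.1 (q.2 - 1)) (blockVertex N u v q.1 q.2)
      (blockVertex N u v q.1 j) := by
  decide +kernel

theorem blockTips_orient_right : ∀ N < 10, ∀ (u v : Bool), ∀ q ∈ blockTips N, ∀ j < N,
    q.2 + 1 < j → 0 < intOrient (blockVertex N u v q.1 q.2) (blockVertex N u v q.1 (q.2 + 1))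
      (blockVertex N u v q.1 j) := by
  decide +kernel

theorem blockLabel_lt : ∀ N < 10, ∀ (k : Fin 3), ∀ t < N, blockLabel N k t < N := by
  decide +kernel

theorem exists_blockLabel_eq : ∀ N < 10, ∀ (k : Fin 3), ∀ s < N, ∃ t < N, blockLabel N k t = s := by
  decide +kernel

/-- The midpoint of `a b` lies strictly to the left of the edge `c d`, in the open strip that the
edge spans for the functional with coefficients `l` and `m`. -/
def MidpointAbove (l m : ℤ) (a b c d : ℤ × ℤ) : Prop :=
  2 * (l * c.1 + m * c.2) < l * a.1 + m * a.2 + (l * b.1 + m * b.2) ∧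
    l * a.1 + m * a.2 + (l * b.1 + m * b.2) < 2 * (l * d.1 + m * d.2) ∧
    0 < intOrient c d a + intOrient c d b

instance (l m : ℤ) (a b c d : ℤ × ℤ) : Decidable (MidpointAbove l m a b c d) :=
  inferInstanceAs (Decidable (_ ∧ _ ∧ _))

-- This separates the three polygons within one block; blocks of fewer than five points are visited
-- in the same order by all three.
set_option synthInstance.maxHeartbeats 400000 in
set_option synthInstance.maxSize 2000 in
theorem exists_midpointAbove : ∀ N < 10, 5 ≤ N → ∀ (u v : Bool) (k k' : Fin 3),
    (k, k') ∈ [((1 : Fin 3), (0 : Fin 3)), (0, 2), (1, 2)] →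
    ∃ s < N, s + 1 < N ∧ ∃ t < N, t + 1 < N ∧
      MidpointAbove 1 (slope k') (blockVertex N u v k s) (blockVertex N u v k (s + 1))
        (blockVertex N u v k' t) (blockVertex N u v k' (t + 1)) := by
  decide +kernel

set_option synthInstance.maxHeartbeats 400000 in
set_option synthInstance.maxSize 2000 in
theorem le_sum_of_hits : ∀ N < 10, ∀ h : ℕ → Bool,
    (∀ q ∈ blockTips N, h (blockLabel N q.1 (q.2 - 1)) = true ∨ h (blockLabel N q.1 q.2) = true ∨
      h (blockLabel N q.1 (q.2 + 1)) = true) →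
    4 * N / 9 ≤ ∑ s ∈ Finset.range N, (h s).toNat := by
  intro N hN h H
  interval_cases N <;>
    simp only [blockTips, blockLabel, blockOrder, List.forall_mem_cons,
      Finset.sum_range_succ, Finset.sum_range_zero] at H ⊢ <;>
    simp at H ⊢ <;> revert H
  -- Only the values of `h` at the block's labels occur, so at most nine Booleans remain to be
  -- enumerated.
  all_goals
    generalize h 0 = b0
    try generalize h 1 = b1
    try generalize h 2 = b2
    try generalize h 3 = b3
    try generalize h 4 = b4
    try generalize h 5 = b5
    try generalize h 6 = b6
    try generalize h 7 = b7
    try generalize h 8 = b8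
    clear h
    decide +revert +kernel

/-! ### From integral coordinates to the plane -/

/-- The point of the plane with the given integral coordinates. -/
noncomputable def toPlane (q : ℤ × ℤ) : Plane := !₂[(q.1 : ℝ), (q.2 : ℝ)]

@[simp] theorem toPlane_zero (q : ℤ × ℤ) : toPlane q 0 = q.1 := rfl

@[simp] theorem toPlane_one (q : ℤ × ℤ) : toPlane q 1 = q.2 := rfl

theorem orient_toPlane (a b c : ℤ × ℤ) :
    orient (toPlane a) (toPlane b) (toPlane c) = (intOrient a b c : ℤ) := by
  simp [orient, intOrient]

theorem level_toPlane (l m : ℤ) (a : ℤ × ℤ) :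
    level l m (toPlane a) = ((l * a.1 + m * a.2 : ℤ) : ℝ) := by
  simp [level]

theorem isMonotoneChain_toPlane {l m : ℤ} {n : ℕ} {p : ℕ → ℤ × ℤ} (h3 : 3 ≤ n)
    (hl : ∀ i, i + 1 < n → l * (p i).1 + m * (p i).2 < l * (p (i + 1)).1 + m * (p (i + 1)).2)
    (ha : ∀ i, 0 < i → i + 1 < n → 0 < intOrient (p 0) (p (n - 1)) (p i))
    (ht : ∀ i, i + 2 < n → intOrient (p i) (p (i + 1)) (p (i + 2)) ≠ 0) :
    IsMonotoneChain l m n (fun i => toPlane (p i)) where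
  three_le := h3
  level_lt i hi := by simpa only [level_toPlane, Int.cast_lt] using hl i hi
  above i h0 hi := by simpa only [orient_toPlane, Int.cast_pos] using ha i h0 hi
  turn i hi := by simpa only [orient_toPlane, ne_eq, Int.cast_eq_zero] using ht i hi

theorem midpoint_notMem_region {l m : ℤ} {n : ℕ} {p : ℕ → ℤ × ℤ}
    (hp : IsMonotoneChain l m n (fun i => toPlane (p i))) {i : ℕ} (hi : i + 1 < n) {a b : ℤ × ℤ}
    (h : MidpointAbove l m a b (p i) (p (i + 1))) :
    AffineMap.lineMap (toPlane a) (toPlane b) (1 / 2 : ℝ) ∉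
      region (chainPolygon n (fun i => toPlane (p i))) := by
  obtain ⟨h1, h2, h3⟩ := h
  have h1' := (Int.cast_lt (R := ℝ)).2 h1
  have h2' := (Int.cast_lt (R := ℝ)).2 h2
  have h3' := (Int.cast_pos (R := ℝ)).2 h3
  apply hp.notMem_region_of_orient_pos hi
  · simp only [level_lineMap, level_toPlane]
    push_cast at *
    linarith
  · simp only [level_lineMap, level_toPlane]
    push_cast at *
    linarith
  · simp only [orient_lineMap, orient_toPlane]
    push_cast at *
    linarith

theorem injective_fin_three {γ : Type*} {P : Fin 3 → γ} (h10 : P 1 ≠ P 0) (h02 : P 0 ≠ P 2)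
    (h12 : P 1 ≠ P 2) : Function.Injective P := by
  intro i j h
  fin_cases i <;> fin_cases j <;> first | rfl | (exfalso; simp_all)

/-! ### The case of four points -/

section FourPoints

/-- Three orders of the vertices and an interior point of a triangle. -/
def fourVertex : Fin 3 → ℕ → ℤ × ℤ
  | 0 => fun i => [(0, 0), (0, 6), (2, 1), (6, 0)].getD i 0
  | 1 => fun i => [(0, 0), (2, 1), (0, 6), (6, 0)].getD i 0
  | 2 => fun i => [(6, 0), (2, 1), (0, 0), (0, 6)].getD i 0

/-- The coefficients of functionals that increase along the three orders. -/
def fourLevel : Fin 3 → ℤ × ℤ := ![(5, 1), (2, 1), (-1, 1)]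

theorem isMonotoneChain_fourVertex (k : Fin 3) :
    IsMonotoneChain (fourLevel k).1 (fourLevel k).2 4 (fun i => toPlane (fourVertex k i)) := by
  apply isMonotoneChain_toPlane (by norm_num)
  · intro i hi
    have : i < 4 := by omega
    interval_cases i <;> first | omega | (revert k; decide)
  · intro i h0 hi
    have : i < 4 := by omega
    interval_cases i <;> first | omega | (revert k; decide)
  · intro i hi
    have : i < 4 := by omega
    interval_cases i <;> first | omega | (revert k; decide)

theorem one_le_kUniversalGuardNumber_four : ((1 : ℕ) : ℕ∞) ≤ kUniversalGuardNumber 3 4 := by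
  classical
  let S : Finset Plane := (Finset.range 4).image fun i => toPlane (fourVertex 0 i)
  have hS : ∀ k z, z ∈ S ↔ ∃ i < 4, toPlane (fourVertex k i) = z := by
    intro k z
    have h1 : ∀ i < 4, ∃ j < 4, fourVertex k j = fourVertex 0 i := by decide +revert
    have h2 : ∀ i < 4, ∃ j < 4, fourVertex 0 j = fourVertex k i := by decide +revert
    simp only [S, Finset.mem_image, Finset.mem_range]
    constructor
    · rintro ⟨i, hi, rfl⟩
      obtain ⟨j, hj, h⟩ := h1 i hi
      exact ⟨j, hj, by rw [h]⟩
    · rintro ⟨i, hi, rfl⟩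
      obtain ⟨j, hj, h⟩ := h2 i hi
      exact ⟨j, hj, by rw [h]⟩
  have hcard : S.card = 4 := by
    rw [Finset.card_image_of_injOn, Finset.card_range]
    rw [Finset.coe_range]
    exact (isMonotoneChain_fourVertex 0).injOn
  refine le_kUniversalGuardNumber hcard
    (P := fun k => region (chainPolygon 4 fun i => toPlane (fourVertex k i)))
    (fun k => (isMonotoneChain_fourVertex k).region_mem_simplePolygons (hS k)) ?_ ?_
  · apply injective_fin_three
    · intro h
      refine midpoint_notMem_region (isMonotoneChain_fourVertex 1) (i := 0) (by norm_num)
        (a := fourVertex 0 0) (b := fourVertex 0 1) (by decide) ?_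
      rw [h]
      exact IsMonotoneChain.midpoint_mem_region (p := fun i => toPlane (fourVertex 0 i))
        (by norm_num)
    · intro h
      refine midpoint_notMem_region (isMonotoneChain_fourVertex 0) (i := 2) (by norm_num)
        (a := fourVertex 2 3) (b := fourVertex 2 0) (by decide) ?_
      rw [h]
      exact IsMonotoneChain.chord_midpoint_mem_region (n := 4)
        (p := fun i => toPlane (fourVertex 2 i)) (by norm_num)
    · intro h
      refine midpoint_notMem_region (isMonotoneChain_fourVertex 1) (i := 0) (by norm_num)
        (a := fourVertex 2 2) (b := fourVertex 2 3) (by decide) ?_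
      rw [h]
      exact IsMonotoneChain.midpoint_mem_region (p := fun i => toPlane (fourVertex 2 i))
        (by norm_num)
  · intro G _ hG
    rw [Nat.one_le_iff_ne_zero, Finset.card_ne_zero, Finset.nonempty_iff_ne_empty]
    rintro rfl
    have h := IsMonotoneChain.vertex_mem_region (n := 4)
      (p := fun i => toPlane (fourVertex 0 i)) 0 (by norm_num)
    rw [← hG 0] at h
    simp at h

end FourPoints

/-! ### Joining the blocks -/

/-- The size of the `j`-th block of `n` points. -/
def blockSize (n j : ℕ) : ℕ := if j < n / 9 then 9 else n % 9

/-- The `s`-th point of the `j`-th block of `n` points. -/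
def gridPoint (n j s : ℕ) : ℤ × ℤ :=
  let q := blockPoint (blockSize n j) (decide (j = 0)) (decide (n ≤ 9 * j + 9)) s
  (10000 * j + q.1, q.2)

/-- The `i`-th vertex of the `k`-th polygon on `n` points. -/
def vertex (n : ℕ) (k : Fin 3) (i : ℕ) : ℤ × ℤ :=
  gridPoint n (i / 9) (blockLabel (blockSize n (i / 9)) k (i % 9))

theorem blockSize_lt_ten (n j : ℕ) : blockSize n j < 10 := by
  unfold blockSize; split_ifs <;> omega

theorem add_lt_of_lt_blockSize {j t : ℕ} (hj : j ≤ n / 9) (ht : t < blockSize n j) :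
    9 * j + t < n := by
  unfold blockSize at ht; split_ifs at ht <;> omega

theorem exists_block {i : ℕ} (hi : i < n) :
    ∃ j t, i = 9 * j + t ∧ j ≤ n / 9 ∧ t < blockSize n j := by
  refine ⟨i / 9, i % 9, by omega, by omega, ?_⟩
  unfold blockSize; split_ifs <;> omega

theorem five_le_blockSize_zero (hn : 5 ≤ n) : 5 ≤ blockSize n 0 := by
  unfold blockSize; split_ifs <;> omega

/-- At the end of a block that is not the last one. -/
theorem blockSize_eq_nine {j t : ℕ} (ht : t + 1 = blockSize n j) (h : 9 * j + t + 1 < n) :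
    blockSize n j = 9 ∧ j + 1 ≤ n / 9 ∧ 0 < blockSize n (j + 1) := by
  unfold blockSize at *; split_ifs at * <;> omega

theorem vertex_block (n j : ℕ) (k : Fin 3) {t : ℕ} (ht : t < 9) : vertex n k (9 * j + t) =
    (10000 * j +
        (blockVertex (blockSize n j) (decide (j = 0)) (decide (n ≤ 9 * j + 9)) k t).1,
      (blockVertex (blockSize n j) (decide (j = 0)) (decide (n ≤ 9 * j + 9)) k t).2) := by
  rw [vertex, show (9 * j + t) / 9 = j by omega, show (9 * j + t) % 9 = t by omega]
  rfl

theorem slope_mem (k : Fin 3) : slope k = -1 ∨ slope k = 0 ∨ slope k = 1 := by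
  revert k; decide

theorem intOrient_translate (d : ℤ) (a b c : ℤ × ℤ) :
    intOrient (d + a.1, a.2) (d + b.1, b.2) (d + c.1, c.2) = intOrient a b c := by
  simp only [intOrient]; ring

theorem vertex_level_lt (k : Fin 3) (i : ℕ) (hi : i + 1 < n) :
    1 * (vertex n k i).1 + slope k * (vertex n k i).2 <
      1 * (vertex n k (i + 1)).1 + slope k * (vertex n k (i + 1)).2 := by
  obtain ⟨j, t, rfl, hj, ht⟩ := exists_block (show i < n by omega)
  have h10 := blockSize_lt_ten n j
  rcases (show t + 1 < blockSize n j ∨ t + 1 = blockSize n j by omega) with h | h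
  · rw [add_assoc, vertex_block n j k (by omega), vertex_block n j k (by omega)]
    have := blockVertex_level_lt _ h10 (decide (j = 0)) (decide (n ≤ 9 * j + 9)) k t ht h
    simp only
    linarith
  · obtain ⟨h9, -, h0⟩ := blockSize_eq_nine h hi
    rw [show 9 * j + t + 1 = 9 * (j + 1) + 0 by omega, vertex_block n j k (by omega),
      vertex_block n (j + 1) k (by omega)]
    have b1 := blockVertex_mem_box _ h10 (decide (j = 0)) (decide (n ≤ 9 * j + 9)) k t ht
    have b2 := blockVertex_mem_box _ (blockSize_lt_ten n (j + 1)) (decide (j + 1 = 0))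
      (decide (n ≤ 9 * (j + 1) + 9)) k 0 h0
    simp only [Nat.cast_add, Nat.cast_one]
    rcases slope_mem k with hs | hs | hs <;> rw [hs] <;> linarith

theorem vertex_level_lt_of_lt (k : Fin 3) {i j : ℕ} (hij : i < j) (hj : j < n) :
    1 * (vertex n k i).1 + slope k * (vertex n k i).2 <
      1 * (vertex n k j).1 + slope k * (vertex n k j).2 :=
  lt_of_forall_lt_succ (f := fun i => 1 * (vertex n k i).1 + slope k * (vertex n k i).2)
    (vertex_level_lt k) hij hj

theorem vertex_snd_zero (hn : 5 ≤ n) (k : Fin 3) : (vertex n k 0).2 = 0 := by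
  rw [show 0 = 9 * 0 + 0 by rfl, vertex_block n 0 k (by norm_num)]
  exact blockVertex_snd_first _ (blockSize_lt_ten n 0) (five_le_blockSize_zero hn) _ k

theorem vertex_snd_last (hn : 5 ≤ n) (k : Fin 3) : (vertex n k (n - 1)).2 = 0 := by
  obtain ⟨j, t, h, hj, ht⟩ := exists_block (show n - 1 < n by omega)
  have h10 := blockSize_lt_ten n j
  have ht' : t = blockSize n j - 1 := by
    by_contra hne
    have := add_lt_of_lt_blockSize hj (show t + 1 < blockSize n j by omega)
    omega
  have h5 : 5 ≤ blockSize n j ∨ decide (j = 0) = false := by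
    rcases Nat.eq_zero_or_pos j with rfl | h0
    · exact Or.inl (five_le_blockSize_zero hn)
    · exact Or.inr (by simpa using h0.ne')
  rw [h, vertex_block n j k (by omega), decide_eq_true (show n ≤ 9 * j + 9 by omega), ht']
  exact blockVertex_snd_last _ h10 (by omega) _ k h5

theorem vertex_snd_pos (k : Fin 3) {i : ℕ} (h0 : 0 < i) (hi : i + 1 < n) :
    0 < (vertex n k i).2 := by
  obtain ⟨j, t, rfl, hj, ht⟩ := exists_block (show i < n by omega)
  have h10 := blockSize_lt_ten n j
  rw [vertex_block n j k (by omega)]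
  apply blockVertex_snd_pos _ h10 _ _ k t ht
  · simp only [decide_eq_true_eq]
    omega
  · simp only [decide_eq_true_eq]
    rintro ⟨h1, h2⟩
    obtain ⟨h9, h3, h4⟩ := blockSize_eq_nine h2 hi
    omega

/-- Both ends have height 0, so the orientation is the length of the chord times the positive height
of the vertex. This is what lowering the two ends achieves. -/
theorem vertex_above (hn : 5 ≤ n) (k : Fin 3) {i : ℕ} (h0 : 0 < i) (hi : i + 1 < n) :
    0 < intOrient (vertex n k 0) (vertex n k (n - 1)) (vertex n k i) := by
  have h1 := vertex_level_lt_of_lt (n := n) k (show 0 < n - 1 by omega) (by omega)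
  have h2 := vertex_snd_pos k h0 hi
  rw [vertex_snd_zero hn, vertex_snd_last hn] at h1
  simp only [intOrient, vertex_snd_zero hn, vertex_snd_last hn]
  nlinarith

/-- Here `d` is a horizontal distance between blocks, at least 10000 - 80, and it outweighs any
product 80 * 40 of displacements inside the boxes. -/
theorem mul_sub_mul_ne_zero {a b c d : ℤ} (ha : |a| ≤ 80) (hb : |b| ≤ 40) (hc : c ≠ 0)
    (hd : 9920 ≤ d) : a * b - c * d ≠ 0 := by
  intro h
  have h1 : |c * d| ≤ 80 * 40 := by
    rw [← sub_eq_zero.1 h, abs_mul]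
    exact mul_le_mul ha hb (abs_nonneg _) (by norm_num)
  rw [abs_mul, abs_of_nonneg (show 0 ≤ d by linarith)] at h1
  have := Int.one_le_abs hc
  nlinarith

theorem vertex_turn (k : Fin 3) (i : ℕ) (hi : i + 2 < n) :
    intOrient (vertex n k i) (vertex n k (i + 1)) (vertex n k (i + 2)) ≠ 0 := by
  obtain ⟨j, t, rfl, hj, ht⟩ := exists_block (show i < n by omega)
  have h10 := blockSize_lt_ten n j
  have h10' := blockSize_lt_ten n (j + 1)
  set u := decide (j = 0) with hu
  set v := decide (n ≤ 9 * j + 9) with hv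
  set v' := decide (n ≤ 9 * (j + 1) + 9) with hv'
  rcases (show t + 2 < blockSize n j ∨ t + 2 = blockSize n j ∨ t + 1 = blockSize n j by omega)
    with h | h | h
  · rw [add_assoc, add_assoc, vertex_block n j k (by omega), vertex_block n j k (by omega),
      vertex_block n j k (by omega), intOrient_translate]
    exact blockVertex_turn _ h10 u v k t ht h
  · obtain ⟨h9, -, h0⟩ := blockSize_eq_nine (t := t + 1) (j := j) (n := n) h (by omega)
    obtain rfl : t = 7 := by omega
    rw [show 9 * j + 7 + 2 = 9 * (j + 1) + 0 by omega, add_assoc, vertex_block n j k (by omega),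
      vertex_block n j k (by omega), vertex_block n (j + 1) k (by omega)]
    have b1 := blockVertex_mem_box _ h10 u v k 7 ht
    have b2 := blockVertex_mem_box _ h10 u v k 8 (by omega)
    have b3 := blockVertex_mem_box _ h10' (decide (j + 1 = 0)) v' k 0 h0
    have hne := blockVertex_snd_last_ne u v k
    rw [← h9] at hne
    simp only [intOrient, Nat.cast_add, Nat.cast_one]
    apply mul_sub_mul_ne_zero
    · rw [abs_le]; constructor <;> linarith
    · rw [abs_le]; constructor <;> linarith
    · exact sub_ne_zero.2 hne.symm
    · linarith
  · obtain ⟨h9, hj', h0⟩ := blockSize_eq_nine h (by omega)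
    obtain rfl : t = 8 := by omega
    have h2 : 2 ≤ blockSize n (j + 1) := by
      unfold blockSize; split_ifs <;> omega
    rw [show 9 * j + 8 + 2 = 9 * (j + 1) + 1 by omega,
      show 9 * j + 8 + 1 = 9 * (j + 1) + 0 by omega, vertex_block n j k (by omega),
      vertex_block n (j + 1) k (by omega), vertex_block n (j + 1) k (by omega),
      decide_eq_false (Nat.succ_ne_zero j)]
    have b1 := blockVertex_mem_box _ h10 u v k 8 ht
    have b2 := blockVertex_mem_box _ h10' false v' k 0 h0
    have b3 := blockVertex_mem_box _ h10' false v' k 1 (by omega)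
    have hne := blockVertex_snd_zero_ne _ h10' h2 v' k
    simp only [intOrient, Nat.cast_add, Nat.cast_one]
    -- The long edge now comes first, so the determinant has the opposite sign to the form `a * b -
    -- c * d`.
    rw [← neg_ne_zero]
    convert mul_sub_mul_ne_zero (a := (blockVertex (blockSize n (j + 1)) false v' k 1).1 -
        (blockVertex (blockSize n (j + 1)) false v' k 0).1)
      (b := (blockVertex (blockSize n (j + 1)) false v' k 0).2 -
        (blockVertex (blockSize n j) u v k 8).2)
      (c := (blockVertex (blockSize n (j + 1)) false v' k 1).2 -
        (blockVertex (blockSize n (j + 1)) false v' k 0).2)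
      (d := 10000 + (blockVertex (blockSize n (j + 1)) false v' k 0).1 -
        (blockVertex (blockSize n j) u v k 8).1) ?_ ?_ (sub_ne_zero.2 hne.symm) ?_ using 1
    · ring
    · rw [abs_le]; constructor <;> linarith
    · rw [abs_le]; constructor <;> linarith
    · linarith

theorem isMonotoneChain_vertex (hn : 5 ≤ n) (k : Fin 3) :
    IsMonotoneChain (1 : ℤ) (slope k) n (fun i => toPlane (vertex n k i)) :=
  isMonotoneChain_toPlane (by omega) (vertex_level_lt k) (fun _ => vertex_above hn k)
    (vertex_turn k)

/-- Within the block this is tabulated. For an earlier block, the edge rises by at least 1 and the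
distance is at least 9920, which beats the other term of the determinant, at most 80 * 40. -/
theorem vertex_tip_left {j j' t t' : ℕ} {k : Fin 3} (h : (k, t) ∈ blockTips (blockSize n j))
    (ht' : t' < blockSize n j') (hlt : 9 * j' + t' + 1 < 9 * j + t) :
    0 < intOrient (vertex n k (9 * j + t - 1)) (vertex n k (9 * j + t))
      (vertex n k (9 * j' + t')) := by
  have h10 := blockSize_lt_ten n j
  have h10' := blockSize_lt_ten n j'
  obtain ⟨h0, h1⟩ := blockTips_bounds _ h10 _ h
  simp only at h0 h1
  rw [Nat.add_sub_assoc h0, vertex_block n j k (by omega), vertex_block n j k (by omega),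
    vertex_block n j' k (by omega)]
  rcases (show j' = j ∨ j' < j by omega) with rfl | hj
  · rw [intOrient_translate]
    exact blockTips_orient_left _ h10 _ _ _ h t' ht' (by simp only; omega)
  · set u := decide (j = 0)
    set v := decide (n ≤ 9 * j + 9)
    have hy := (blockTips_snd_lt _ h10 u v _ h).1
    have b1 := blockVertex_mem_box _ h10 u v k (t - 1) (by omega)
    have b2 := blockVertex_mem_box _ h10 u v k t (by omega)
    have b3 := blockVertex_mem_box _ h10' (decide (j' = 0)) (decide (n ≤ 9 * j' + 9)) k t' ht'
    have hjj : (j' : ℤ) + 1 ≤ j := by exact_mod_cast hj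
    simp only [intOrient] at *
    nlinarith

theorem vertex_tip_right {j j' t t' : ℕ} {k : Fin 3} (h : (k, t) ∈ blockTips (blockSize n j))
    (ht' : t' < blockSize n j') (hlt : 9 * j + t + 1 < 9 * j' + t') :
    0 < intOrient (vertex n k (9 * j + t)) (vertex n k (9 * j + t + 1))
      (vertex n k (9 * j' + t')) := by
  have h10 := blockSize_lt_ten n j
  have h10' := blockSize_lt_ten n j'
  obtain ⟨h0, h1⟩ := blockTips_bounds _ h10 _ h
  simp only at h0 h1
  rw [add_assoc, vertex_block n j k (by omega), vertex_block n j k (by omega),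
    vertex_block n j' k (by omega)]
  rcases (show j' = j ∨ j < j' by omega) with rfl | hj
  · rw [intOrient_translate]
    exact blockTips_orient_right _ h10 _ _ _ h t' ht' (by simp only; omega)
  · set u := decide (j = 0)
    set v := decide (n ≤ 9 * j + 9)
    have hy := (blockTips_snd_lt _ h10 u v _ h).2
    have b1 := blockVertex_mem_box _ h10 u v k t (by omega)
    have b2 := blockVertex_mem_box _ h10 u v k (t + 1) (by omega)
    have b3 := blockVertex_mem_box _ h10' (decide (j' = 0)) (decide (n ≤ 9 * j' + 9)) k t' ht'
    have hjj : (j : ℤ) + 1 ≤ j' := by exact_mod_cast hj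
    simp only [intOrient] at *
    nlinarith

theorem exists_mem_guardSet_vertex (hn : 5 ≤ n) {G : Finset Plane} {k : Fin 3}
    (hG : ∀ g ∈ G, ∃ i < n, g = toPlane (vertex n k i))
    (hguard : IsGuardSet G (region (chainPolygon n fun i => toPlane (vertex n k i))))
    {j t : ℕ} (hj : j ≤ n / 9) (h : (k, t) ∈ blockTips (blockSize n j)) :
    toPlane (vertex n k (9 * j + t - 1)) ∈ G ∨ toPlane (vertex n k (9 * j + t)) ∈ G ∨
      toPlane (vertex n k (9 * j + t + 1)) ∈ G := by
  obtain ⟨h0, h1⟩ := blockTips_bounds _ (blockSize_lt_ten n j) _ h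
  have hlt : 9 * j + (t + 1) < n := add_lt_of_lt_blockSize hj h1
  refine (isMonotoneChain_vertex hn k).exists_mem_guardSet hG hguard (i := 9 * j + t)
    (by simp only at h0; omega) (by omega) ?_ ?_
  · intro i hi
    obtain ⟨j', t', rfl, -, ht'⟩ := exists_block (show i < n by omega)
    simpa only [orient_toPlane, Int.cast_pos] using vertex_tip_left h ht' hi
  · intro i hi hin
    obtain ⟨j', t', rfl, -, ht'⟩ := exists_block hin
    simpa only [orient_toPlane, Int.cast_pos] using vertex_tip_right h ht' hi

/-! ### Counting guards and conclusion -/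

/-- The point set on which the three polygons live. -/
noncomputable def gridPoints (n : ℕ) : Finset Plane :=
  (Finset.range n).image fun i => toPlane (gridPoint n (i / 9) (i % 9))

theorem mem_gridPoints_iff (k : Fin 3) (z : Plane) :
    z ∈ gridPoints n ↔ ∃ i < n, toPlane (vertex n k i) = z := by
  simp only [gridPoints, Finset.mem_image, Finset.mem_range]
  constructor
  · rintro ⟨i, hi, rfl⟩
    obtain ⟨j, s, rfl, hj, hs⟩ := exists_block hi
    have h10 := blockSize_lt_ten n j
    obtain ⟨t, ht, hts⟩ := exists_blockLabel_eq _ h10 k s hs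
    refine ⟨9 * j + t, add_lt_of_lt_blockSize hj ht, ?_⟩
    rw [vertex, show (9 * j + t) / 9 = j by omega, show (9 * j + t) % 9 = t by omega,
      show (9 * j + s) / 9 = j by omega, show (9 * j + s) % 9 = s by omega, hts]
  · rintro ⟨i, hi, rfl⟩
    obtain ⟨j, t, rfl, hj, ht⟩ := exists_block hi
    have h10 := blockSize_lt_ten n j
    have hs := blockLabel_lt _ h10 k t ht
    refine ⟨9 * j + blockLabel (blockSize n j) k t, add_lt_of_lt_blockSize hj hs, ?_⟩
    rw [vertex, show (9 * j + t) / 9 = j by omega, show (9 * j + t) % 9 = t by omega,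
      show (9 * j + blockLabel (blockSize n j) k t) / 9 = j by omega,
      show (9 * j + blockLabel (blockSize n j) k t) % 9 = blockLabel (blockSize n j) k t by omega]

theorem card_gridPoints (hn : 5 ≤ n) : (gridPoints n).card = n := by
  have h : gridPoints n = (Finset.range n).image fun i => toPlane (vertex n 0 i) := by
    ext z
    simp only [mem_gridPoints_iff 0, Finset.mem_image, Finset.mem_range]
  rw [h, Finset.card_image_of_injOn, Finset.card_range]
  rw [Finset.coe_range]
  exact (isMonotoneChain_vertex hn 0).injOn

theorem injOn_gridPoint (hn : 5 ≤ n) :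
    Set.InjOn (fun i => toPlane (gridPoint n (i / 9) (i % 9))) (Finset.range n) := by
  rw [← Finset.card_image_iff, Finset.card_range]
  exact card_gridPoints hn

/-- Nothing is lost to rounding: a full block contributes exactly 4, so only the remainder block is
rounded down. -/
theorem le_sum_of_le_sum_blocks {f : ℕ → ℕ}
    (h : ∀ j ≤ n / 9, 4 * blockSize n j / 9 ≤ ∑ s ∈ Finset.range (blockSize n j), f (9 * j + s)) :
    4 * n / 9 ≤ ∑ i ∈ Finset.range n, f i := by
  have h1 : ∀ m ≤ n / 9, 4 * m ≤ ∑ i ∈ Finset.range (9 * m), f i := by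
    intro m
    induction m with
    | zero => simp
    | succ m ih =>
      intro hm
      have h2 := h m (by omega)
      rw [show blockSize n m = 9 by unfold blockSize; rw [if_pos (by omega)]] at h2
      rw [show 9 * (m + 1) = 9 * m + 9 by ring, Finset.sum_range_add]
      have := ih (by omega)
      omega
  have h2 := h (n / 9) le_rfl
  rw [show blockSize n (n / 9) = n % 9 by unfold blockSize; rw [if_neg (by omega)]] at h2
  have h3 := h1 (n / 9) le_rfl
  have h4 := Finset.sum_range_add f (9 * (n / 9)) (n % 9)
  rw [Nat.div_add_mod] at h4
  omega

theorem le_card_of_isGuardSet (hn : 5 ≤ n) {G : Finset Plane} (hG : G ⊆ gridPoints n)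
    (h : ∀ k, IsGuardSet G (region (chainPolygon n fun i => toPlane (vertex n k i)))) :
    4 * n / 9 ≤ G.card := by
  classical
  have hle : ∑ i ∈ Finset.range n,
      (decide (toPlane (gridPoint n (i / 9) (i % 9)) ∈ G)).toNat ≤ G.card := by
    have : ∀ i, (decide (toPlane (gridPoint n (i / 9) (i % 9)) ∈ G)).toNat =
        if toPlane (gridPoint n (i / 9) (i % 9)) ∈ G then 1 else 0 := by
      intro i; split_ifs with hi <;> simp [hi]
    simp only [this]
    rw [← Finset.card_filter]
    -- Different indices give different points, so no guard is counted twice.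
    refine Finset.card_le_card_of_injOn _ (fun i hi => (Finset.mem_filter.1 hi).2) ?_
    exact (injOn_gridPoint hn).mono (Finset.coe_subset.2 (Finset.filter_subset _ _))
  refine le_trans (le_sum_of_le_sum_blocks fun j hj => ?_) hle
  have h10 := blockSize_lt_ten n j
  have hsum : ∀ s ∈ Finset.range (blockSize n j),
      (decide (toPlane (gridPoint n ((9 * j + s) / 9) ((9 * j + s) % 9)) ∈ G)).toNat =
      (decide (toPlane (gridPoint n j s) ∈ G)).toNat := by
    intro s hs
    have := Finset.mem_range.1 hs
    rw [show (9 * j + s) / 9 = j by omega, show (9 * j + s) % 9 = s by omega]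
  rw [Finset.sum_congr rfl hsum]
  refine le_sum_of_hits _ h10 (fun s => decide (toPlane (gridPoint n j s) ∈ G)) ?_
  rintro ⟨k, t⟩ hq
  obtain ⟨h0, h1⟩ := blockTips_bounds _ h10 _ hq
  simp only at h0 h1
  have hv : ∀ t < 9, vertex n k (9 * j + t) = gridPoint n j (blockLabel (blockSize n j) k t) := by
    intro t ht
    rw [vertex, show (9 * j + t) / 9 = j by omega, show (9 * j + t) % 9 = t by omega]
  have := exists_mem_guardSet_vertex hn (k := k)
    (fun g hg => by
      obtain ⟨i, hi, h⟩ := (mem_gridPoints_iff k g).1 (hG hg)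
      exact ⟨i, hi, h.symm⟩) (h k) hj hq
  rw [Nat.add_sub_assoc h0, add_assoc, hv _ (by omega), hv _ (by omega), hv _ (by omega)] at this
  simpa only [decide_eq_true_eq] using this

/-- The midpoint of an edge of polygon `k` in the first block lies above an edge of polygon `k'`,
hence outside it. -/
theorem region_vertex_ne (hn : 5 ≤ n) {k k' : Fin 3}
    (h : (k, k') ∈ [((1 : Fin 3), (0 : Fin 3)), (0, 2), (1, 2)]) :
    region (chainPolygon n fun i => toPlane (vertex n k i)) ≠
      region (chainPolygon n fun i => toPlane (vertex n k' i)) := by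
  intro heq
  have h10 := blockSize_lt_ten n 0
  obtain ⟨s, hs, hs1, t, ht, ht1, hm⟩ := exists_midpointAbove _ h10 (five_le_blockSize_zero hn)
    (decide (0 = 0)) (decide (n ≤ 9 * 0 + 9)) k k' h
  have hv : ∀ k, ∀ t < 9, vertex n k t =
      blockVertex (blockSize n 0) (decide (0 = 0)) (decide (n ≤ 9 * 0 + 9)) k t := by
    intro k t ht
    have := vertex_block n 0 k ht
    simpa using this
  rw [← hv _ _ (by omega), ← hv _ _ (by omega), ← hv _ _ (by omega), ← hv _ _ (by omega)] at hm
  have hlt := add_lt_of_lt_blockSize (n := n) (Nat.zero_le _) ht1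
  have hlt' := add_lt_of_lt_blockSize (n := n) (Nat.zero_le _) hs1
  refine midpoint_notMem_region (isMonotoneChain_vertex hn k') (by omega) hm ?_
  rw [← heq]
  exact IsMonotoneChain.midpoint_mem_region (p := fun i => toPlane (vertex n k i)) (by omega)

theorem le_kUniversalGuardNumber_three (hn : 5 ≤ n) :
    ((4 * n / 9 : ℕ) : ℕ∞) ≤ kUniversalGuardNumber 3 n := by
  refine le_kUniversalGuardNumber (card_gridPoints hn)
    (P := fun k => region (chainPolygon n fun i => toPlane (vertex n k i)))
    (fun k => (isMonotoneChain_vertex hn k).region_mem_simplePolygons (mem_gridPoints_iff k)) ?_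
    (fun G hG h => le_card_of_isGuardSet hn hG h)
  exact injective_fin_three (region_vertex_ne hn (by decide)) (region_vertex_ne hn (by decide))
    (region_vertex_ne hn (by decide))

end UniversalGuards

theorem mainTheorem10 (n : ℕ) (hn : 4 ≤ n) :
    ((4 * n / 9 : ℕ) : ℕ∞) ≤ UniversalGuards.kUniversalGuardNumber 3 n := by
  rcases hn.eq_or_lt with rfl | h
  · exact UniversalGuards.one_le_kUniversalGuardNumber_four
  · exact UniversalGuards.le_kUniversalGuardNumber_three h
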